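/- A CNF formula is a finite set of clauses, a clause being a finite set of literals (Boolean variables or negated variables). For integers $k\ge 1$ and $s\ge 0$, a $(k,s)$-CNF formula is a CNF formula in which every clause has exactly $k$ distinct literals and every variable occurs in at most $s$ clauses; it is called balanced if every literal occurs in at most $s/2$ clauses. Put $$f(k)=\max\{s:\text{every }(k,s)\text{-CNF formula is satisfiable}\},\qquad f_{\mathsf{bal}}(k)=\max\{s:\text{every balanced }(k,s)\text{-CNF formula is satisfiable}\}.$$ These maxima exist for every $k\ge 1$, and the following hold. 1. If $k$ is a sufficiently large power of $2$, then $f_{\mathsf{bal}}(k)\le \frac{2^k}{k}-1$. 2. For every sufficiently large $k$ (not necessarily a power of $2$), $f_{\mathsf{bal}}(k)\le 2\cdot\frac{2^k}{k}-1$. 3. $f(k)=\Theta\!\left(\frac{2^k}{k}\right)$ as $k\to\infty$. -/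

import Mathlib

open Filter Asymptotics

namespace KSat

/-- A literal over the countable supply of variables `x₀, x₁, …`: the pair `(x, true)` is the
positive literal `x`, the pair `(x, false)` is the negated literal. -/
abbrev Literal : Type := ℕ × Bool

/-- A clause is a finite set (disjunction) of literals. -/
abbrev Clause : Type := Finset Literal

/-- A formula in conjunctive normal form is a finite set (conjunction) of clauses. -/
abbrev Formula : Type := Finset Clause

/-- A truth assignment satisfies a formula if every clause contains a literal made true. -/
def Satisfies (α : ℕ → Bool) (F : Formula) : Prop :=
  ∀ C ∈ F, ∃ l ∈ C, α l.1 = l.2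

def Satisfiable (F : Formula) : Prop :=
  ∃ α : ℕ → Bool, Satisfies α F

/-- The number of clauses in which the variable `x` occurs (positively or negated). -/
def varOcc (F : Formula) (x : ℕ) : ℕ :=
  (F.filter fun C => (x, true) ∈ C ∨ (x, false) ∈ C).card

/-- The number of clauses in which the literal `l` occurs. -/
def litOcc (F : Formula) (l : Literal) : ℕ :=
  (F.filter fun C => l ∈ C).card

/-- `(k,s)`-CNF: every clause has exactly `k` distinct literals, and every variable occurs in
at most `s` clauses. -/
def IsKS (k s : ℕ) (F : Formula) : Prop :=
  (∀ C ∈ F, C.card = k) ∧ ∀ x : ℕ, varOcc F x ≤ s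

/-- Balanced `(k,s)`-CNF: in addition every literal occurs in at most `s / 2` clauses. -/
def IsBalancedKS (k s : ℕ) (F : Formula) : Prop :=
  IsKS k s F ∧ ∀ l : Literal, (litOcc F l : ℝ) ≤ (s : ℝ) / 2

/-- The set of all `s` such that every `(k,s)`-CNF formula is satisfiable. -/
def satSet (k : ℕ) : Set ℕ :=
  {s | ∀ F : Formula, IsKS k s F → Satisfiable F}

/-- The set of all `s` such that every balanced `(k,s)`-CNF formula is satisfiable. -/
def satSetBal (k : ℕ) : Set ℕ :=
  {s | ∀ F : Formula, IsBalancedKS k s F → Satisfiable F}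

/-- `f(k)`, the largest `s` such that every `(k,s)`-CNF formula is satisfiable. -/
noncomputable def f (k : ℕ) : ℕ := sSup (satSet k)

/-- `f_bal(k)`, the largest `s` such that every balanced `(k,s)`-CNF formula is satisfiable. -/
noncomputable def fBal (k : ℕ) : ℕ := sSup (satSetBal k)

end KSat

/-! Upper bounds. In a binary tree let inner vertices be variables and edges literals, and give each
leaf the clause of the last `k` edges above it. Walking down against an assignment ends at a leaf
whose clause is false. A literal lies only in clauses of leaves at distance less than `k` below its
edge. So a tree with no leaf at depth below `k`, each vertex of which has at most `D` leaves at
distance below `k`, yields an unsatisfiable balanced `(k, 2D)`-formula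
(`exists_balanced_not_satisfiable`).

For `k = 8 * 2 ^ n`, `exists_tree_pow` attains `D = 2 ^ k / (2 * k)`. The block `S = slots n 0` has
fewer than `2 ^ (r - n)` leaves at depth below `r`. Copies of `S` are hung every `P ≈ k / 7` levels,
at a growing proportion of the surviving vertices. Of the generations in a window of length `k` only
the newest one, six periods down, has a sizeable count, and it may use a fraction 1/16 of the
vertices at its level. The process can end because the maximum `6 ^ 6 / 7 ^ 7` of `x * (1 - x) ^ 6`
is below 1/16. For other `k`, `dbl` raises `k` by one and doubles `D`.

Lower bound. The local lemma, proved by counting models, makes every `(k, s)`-formula with `4 * k *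
s ≤ 2 ^ k` and `k ≥ 2` satisfiable. -/

namespace KSat

/-! ### Binary trees and their leaf counts. -/

/-- Binary trees in which every inner node has exactly two children. -/
inductive BTree : Type
  | leaf : BTree
  | node : BTree → BTree → BTree

namespace BTree

/-- The number of leaves at depth less than `r`. -/
def lv : BTree → ℕ → ℕ
  | _, 0 => 0
  | leaf, _ + 1 => 1
  | node l r, n + 1 => lv l n + lv r n

/-- Every subtree has at most `D` leaves at depth less than `k`. -/
def Ok (k D : ℕ) : BTree → Prop
  | leaf => lv leaf k ≤ D
  | node l r => lv (node l r) k ≤ D ∧ Ok k D l ∧ Ok k D r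

@[simp] theorem lv_zero (t : BTree) : lv t 0 = 0 := by cases t <;> rfl

@[simp] theorem lv_leaf_succ (n : ℕ) : lv leaf (n + 1) = 1 := rfl

@[simp] theorem lv_node_succ (l r : BTree) (n : ℕ) :
    lv (node l r) (n + 1) = lv l n + lv r n := rfl

theorem lv_mono (t : BTree) : Monotone (lv t) := by
  refine monotone_nat_of_le_succ ?_
  intro n
  induction t generalizing n with
  | leaf => cases n <;> simp
  | node l r hl hr =>
    cases n with
    | zero => simp
    | succ n => simpa using add_le_add (hl n) (hr n)

theorem Ok.lv_le {k D : ℕ} {t : BTree} (h : Ok k D t) : lv t k ≤ D := by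
  cases t with
  | leaf => exact h
  | node l r => exact h.1

theorem ok_of_forall_lv_le {k D : ℕ} {t : BTree} (h : ∀ r, lv t r ≤ D) : Ok k D t := by
  induction t with
  | leaf => exact h k
  | node l r hl hr =>
    refine ⟨h k, hl fun n => ?_, hr fun n => ?_⟩
    · exact le_trans (by simp) (h (n + 1))
    · exact le_trans (by simp) (h (n + 1))

/-- Replace every leaf by a node with two leaves. -/
def dbl : BTree → BTree
  | leaf => node leaf leaf
  | node l r => node (dbl l) (dbl r)

theorem lv_dbl_succ (t : BTree) (n : ℕ) : lv (dbl t) (n + 1) = 2 * lv t n := by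
  induction t generalizing n with
  | leaf => cases n <;> simp [dbl]
  | node l r hl hr =>
    cases n with
    | zero => simp [dbl]
    | succ n => simp [dbl, hl, hr, mul_add]

theorem Ok.dbl {k D : ℕ} (hk : 1 ≤ k) {t : BTree} (h : Ok k D t) : Ok (k + 1) (2 * D) t.dbl := by
  induction t with
  | leaf =>
    obtain ⟨k, rfl⟩ := Nat.exists_eq_add_of_le' hk
    have : 1 ≤ D := h
    refine ⟨?_, ?_, ?_⟩
    · simp; omega
    · show 1 ≤ _; omega
    · show 1 ≤ _; omega
  | node l r hl hr =>
    refine ⟨?_, hl h.2.1, hr h.2.2⟩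
    have := lv_dbl_succ (node l r) k
    have h1 := h.1
    simp only [BTree.dbl] at this
    omega

/-- The tree in which a copy of `t` hangs at each vertex of depth `n`. -/
def full : ℕ → BTree → BTree
  | 0, t => t
  | n + 1, t => node (full n t) (full n t)

theorem lv_full (n : ℕ) (t : BTree) (r : ℕ) : lv (full n t) r = 2 ^ n * lv t (r - n) := by
  induction n generalizing r with
  | zero => simp [full]
  | succ n ih =>
    cases r with
    | zero => simp [full]
    | succ r => simp [full, ih, pow_succ]; ring

theorem ok_full {k D n : ℕ} {t : BTree} (ht : Ok k D t)
    (h : ∀ e, 1 ≤ e → e ≤ n → 2 ^ e * lv t (k - e) ≤ D) : Ok k D (full n t) := by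
  induction n with
  | zero => exact ht
  | succ n ih =>
    have := ih fun e h1 h2 => h e h1 (by omega)
    refine ⟨?_, this, this⟩
    have h1 := lv_full (n + 1) t k
    rw [full] at h1
    rw [h1]
    exact h _ (by omega) le_rfl

/-- The tree of height `q` over copies of `s` and `u`, with `s` at the first `a` of the `2 ^ q`
vertices of depth `q` and `u` at the other ones. -/
def mix : ℕ → ℕ → BTree → BTree → BTree
  | 0, a, s, u => if 1 ≤ a then s else u
  | q + 1, a, s, u => node (mix q a s u) (mix q (a - 2 ^ q) s u)

theorem lv_mix (q a : ℕ) (s u : BTree) (r : ℕ) :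
    lv (mix q a s u) r = min a (2 ^ q) * lv s (r - q) + (2 ^ q - a) * lv u (r - q) := by
  induction q generalizing a r with
  | zero =>
    rcases Nat.eq_zero_or_pos a with rfl | ha
    · simp [mix]
    · have h1 : min a 1 = 1 := by omega
      have h2 : 1 - a = 0 := by omega
      have h3 : 1 ≤ a := ha
      simp [mix, h2, h3]
  | succ q ih =>
    cases r with
    | zero => simp [mix]
    | succ r =>
      have h1 : min a (2 ^ (q + 1)) = min a (2 ^ q) + min (a - 2 ^ q) (2 ^ q) := by
        rw [pow_succ]; omega
      have h2 : 2 ^ (q + 1) - a = (2 ^ q - a) + (2 ^ q - (a - 2 ^ q)) := by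
        rw [pow_succ]; omega
      simp only [mix, lv_node_succ, ih, h1, h2, Nat.add_sub_add_right]
      ring

/-- From a vertex in the top `q` levels, a window of length `k` stays within a window of length `k +
q` at the root. -/
theorem ok_mix {k D q a : ℕ} {s u : BTree} (hs : Ok k D s) (hu : Ok k D u)
    (h : lv (mix q a s u) (k + q) ≤ D) : Ok k D (mix q a s u) := by
  induction q generalizing a with
  | zero => unfold mix; split_ifs <;> assumption
  | succ q ih =>
    have h' : lv (mix q a s u) (k + q) + lv (mix q (a - 2 ^ q) s u) (k + q) ≤ D := h
    exact ⟨(lv_mono _ (by omega)).trans h, ih (by omega), ih (by omega)⟩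

/-! ### The tree for `k` a power of 2. -/

/-- The tree of height `n` whose vertices of depth `n` carry complete binary trees of heights
`j, j + 1, …, j + 2 ^ n - 1`. -/
def slots : ℕ → ℕ → BTree
  | 0, j => full j leaf
  | n + 1, j => node (slots n j) (slots n (j + 2 ^ n))

theorem lv_leaf_le (r : ℕ) : lv leaf r ≤ 1 := by cases r <;> simp

theorem lv_slots_add_le (n j r : ℕ) : lv (slots n j) r + 2 ^ j ≤ 2 ^ (j + 2 ^ n) := by
  induction n generalizing j r with
  | zero =>
    have := Nat.mul_le_mul_left (2 ^ j) (lv_leaf_le (r - j))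
    simp only [slots, lv_full, pow_zero, pow_succ]
    omega
  | succ n ih =>
    cases r with
    | zero =>
      rw [lv_zero, zero_add]
      exact Nat.pow_le_pow_right (by norm_num) (Nat.le_add_right _ _)
    | succ r =>
      have h1 := ih j r
      have h2 := ih (j + 2 ^ n) r
      have h3 : j + 2 ^ (n + 1) = j + 2 ^ n + 2 ^ n := by rw [pow_succ]; ring
      simp only [slots, lv_node_succ, h3]
      omega

/-- Only complete trees of height below `r - n` are visible, and their sizes form a geometric sum.
The slack `2 ^ j`, equal to 1 for `j = 0`, absorbs the older generations in `ok_sched`. -/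
theorem lv_slots_add_le_max (n j r : ℕ) :
    lv (slots n j) r + 2 ^ j ≤ 2 ^ (max (r - n) j) := by
  induction n generalizing j r with
  | zero =>
    rcases le_or_gt r j with h | h
    · have : r - j = 0 := by omega
      simp [slots, lv_full, this, h]
    · have h1 := Nat.mul_le_mul_left (2 ^ j) (lv_leaf_le (r - j))
      have h2 : 2 ^ (j + 1) ≤ 2 ^ max (r - 0) j :=
        Nat.pow_le_pow_right (by norm_num) (by omega)
      rw [pow_succ] at h2
      simp only [slots, lv_full]
      omega
  | succ n ih =>
    cases r with
    | zero => simp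
    | succ r =>
      have h1 := ih j r
      have h2 := ih (j + 2 ^ n) r
      have h3 := lv_slots_add_le n j r
      simp only [slots, lv_node_succ, Nat.add_sub_add_right]
      -- Either the right half shows no leaf, or the left half is counted in full and the two bounds
      -- telescope.
      rcases le_or_gt (r - n) (j + 2 ^ n) with h | h
      · rw [max_eq_right h] at h2
        omega
      · have := Nat.one_le_two_pow (n := n)
        rw [max_eq_left h.le] at h2
        rw [max_eq_left (by omega)]
        omega

/-- The tree built from a list of numbers: the `i`-th entry `b` says that, of the `256` vertices
reached from a vertex at the beginning of the `i`-th period of length `P`, `b` carry a copy of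
`S`. -/
def sched (P : ℕ) (S : BTree) : List ℕ → BTree
  | [] => full 8 S
  | b :: l => mix 8 b S (full (P - 8) (sched P S l))

/-- The (rescaled) number of copies of `S` hanging `C` periods below the top of `sched P S l`. -/
def wt : ℕ → List ℕ → ℕ
  | 0, [] => 256
  | 0, b :: _ => b
  | _ + 1, [] => 0
  | C + 1, b :: l => (256 - b) * wt C l

/-- The condition under which `sched P S l` has few leaves close to each vertex. -/
def Admissible : List ℕ → Prop
  | [] => True
  | b :: l => b ≤ 256 ∧ wt 6 l ≤ 2 ^ 52 ∧ Admissible l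

theorem lv_sched_cons {P : ℕ} (hP : 8 ≤ P) (S : BTree) {b : ℕ} (hb : b ≤ 256) (l : List ℕ)
    (r : ℕ) : lv (sched P S (b :: l)) r =
      b * lv S (r - 8) + (256 - b) * 2 ^ (P - 8) * lv (sched P S l) (r - P) := by
  have h1 : min b (2 ^ 8) = b := by omega
  have h2 : r - 8 - (P - 8) = r - P := by omega
  rw [sched, lv_mix, lv_full, h1, h2, mul_assoc]
  norm_num

/-- The partial sums of the geometric series with ratio `2 ^ P`. -/
def geo (P : ℕ) : ℕ → ℕ
  | 0 => 0
  | C + 1 => 1 + 2 ^ P * geo P C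

theorem geo_succ_add_one_le {P : ℕ} (hP : 1 ≤ P) (C : ℕ) :
    geo P (C + 1) + 1 ≤ 2 ^ (C * P + 1) := by
  induction C with
  | zero => simp [geo]
  | succ C ih =>
    have h2 : 2 ^ 1 ≤ 2 ^ P := Nat.pow_le_pow_right (by norm_num) hP
    have h3 := Nat.mul_le_mul_left (2 ^ P) ih
    have h4 : 2 ^ ((C + 1) * P + 1) = 2 ^ P * 2 ^ (C * P + 1) := by rw [← pow_add]; congr 1; ring
    rw [geo, h4]
    rw [mul_add] at h3
    omega

/-- Generations `c < C` have at most `2 ^ (8 + c * P)` copies, all counted in full; generation `C`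
is counted through its window; `hr` hides the later ones. -/
theorem lv_sched_le {P G : ℕ} (hP : 8 ≤ P) {S : BTree} (hS : ∀ r, lv S r ≤ 2 ^ G) (C : ℕ)
    (l : List ℕ) (hl : Admissible l) (r : ℕ) (hr : r ≤ 8 + (C + 1) * P) :
    lv (sched P S l) r ≤ 2 ^ (8 + G) * geo P C
      + wt C l * 2 ^ (C * (P - 8)) * lv S (r - 8 - C * P) := by
  induction C generalizing l r with
  | zero =>
    cases l with
    | nil => simp [sched, lv_full, wt]
    | cons b l =>
      have h0 : r - P - 8 = 0 := by omega
      have : lv (sched P S l) (r - P) = 0 := by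
        cases l with
        | nil => simp [sched, lv_full, h0]
        | cons b' l => simp [sched, lv_mix, h0]
      rw [lv_sched_cons hP S hl.1, this]
      simp [wt]
  | succ C ih =>
    cases l with
    | nil =>
      have h := Nat.mul_le_mul_left (2 ^ 8) (hS (r - 8))
      rw [sched, lv_full, geo, pow_add]
      calc _ ≤ 2 ^ 8 * 2 ^ G * 1 := by rwa [mul_one]
        _ ≤ 2 ^ 8 * 2 ^ G * (1 + 2 ^ P * geo P C) := by gcongr; omega
        _ ≤ _ := Nat.le_add_right _ _
    | cons b l =>
      have hr' : r - P ≤ 8 + (C + 1) * P := by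
        have : (C + 1 + 1) * P = (C + 1) * P + P := by ring
        omega
      have h := ih l hl.2.2 (r - P) hr'
      have e1 : r - P - 8 - C * P = r - 8 - (C + 1) * P := by
        have : (C + 1) * P = C * P + P := by ring
        omega
      rw [e1] at h
      rw [lv_sched_cons hP S hl.1, geo, wt]
      have e2 : 2 ^ ((C + 1) * (P - 8)) = 2 ^ (P - 8) * 2 ^ (C * (P - 8)) := by
        rw [← pow_add]; congr 1; ring
      have e3 : (2 : ℕ) ^ P = 256 * 2 ^ (P - 8) := by
        rw [show (256 : ℕ) = 2 ^ 8 by norm_num, ← pow_add]; congr 1; omega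
      have h1 : b * lv S (r - 8) ≤ 2 ^ (8 + G) := by
        rw [pow_add]; exact Nat.mul_le_mul hl.1 (hS _)
      have h2 := Nat.mul_le_mul_left ((256 - b) * 2 ^ (P - 8)) h
      have h3 : (256 - b) * 2 ^ (P - 8) * (2 ^ (8 + G) * geo P C) ≤
          2 ^ (8 + G) * (2 ^ P * geo P C) := by
        have : (256 - b) * 2 ^ (P - 8) ≤ 2 ^ P := by
          rw [e3]; exact Nat.mul_le_mul_right _ (by omega)
        calc _ ≤ 2 ^ P * (2 ^ (8 + G) * geo P C) := Nat.mul_le_mul_right _ this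
          _ = _ := by ring
      rw [mul_add] at h2
      rw [e2]
      calc _ ≤ 2 ^ (8 + G) + _ := add_le_add h1 h2
        _ ≤ 2 ^ (8 + G) + (2 ^ (8 + G) * (2 ^ P * geo P C) + _) := by gcongr
        _ = _ := by ring

theorem ok_sched {n P : ℕ} (h1 : 8 * 2 ^ n ≤ 7 * P) (h2 : 2 ^ n + 5 ≤ P)
    (h3 : 6 * P + 2 ^ n + n + 13 ≤ 8 * 2 ^ n) (hP : 8 ≤ P) (l : List ℕ) (hl : Admissible l) :
    Ok (8 * 2 ^ n) (2 ^ (8 * 2 ^ n - n - 4)) (sched P (slots n 0) l) := by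
  have hS : ∀ r, lv (slots n 0) r ≤ 2 ^ 2 ^ n := fun r => by
    have := lv_slots_add_le n 0 r
    rw [zero_add] at this
    omega
  have hOkS : Ok (8 * 2 ^ n) (2 ^ (8 * 2 ^ n - n - 4)) (slots n 0) :=
    ok_of_forall_lv_le fun r => (hS r).trans (Nat.pow_le_pow_right (by norm_num) (by omega))
  induction l with
  | nil =>
    refine ok_of_forall_lv_le fun r => ?_
    rw [sched, lv_full]
    calc _ ≤ 2 ^ 8 * 2 ^ 2 ^ n := Nat.mul_le_mul_left _ (hS _)
      _ = 2 ^ (8 + 2 ^ n) := by rw [pow_add]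
      _ ≤ _ := Nat.pow_le_pow_right (by norm_num) (by omega)
  | cons b l ih =>
    refine ok_mix hOkS (ok_full (ih hl.2.2) fun e he1 he2 => ?_) ?_
    -- A vertex `e` levels above the next period; `hold` bounds generations 0 to 5.
    · have hlv := lv_sched_le hP hS 6 l hl.2.2 (8 * 2 ^ n - e) (by omega)
      have hg : geo P 6 ≤ 2 ^ (5 * P + 1) := by
        have : geo P 6 + 1 ≤ _ := geo_succ_add_one_le (show 1 ≤ P by omega) 5
        omega
      have hold : 2 ^ e * (2 ^ (8 + 2 ^ n) * geo P 6) ≤ 2 ^ (e + 9 + 2 ^ n + 5 * P) := by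
        calc _ ≤ 2 ^ e * (2 ^ (8 + 2 ^ n) * 2 ^ (5 * P + 1)) := by gcongr
          _ = _ := by rw [← pow_add, ← pow_add]; congr 1; ring
      refine (Nat.mul_le_mul_left _ hlv).trans ?_
      rw [mul_add]
      set i := 8 * 2 ^ n - e - 8 - 6 * P with hi
      have hSi := lv_slots_add_le_max n 0 i
      rcases le_or_gt i n with hin | hin
      · have : lv (slots n 0) i = 0 := by
          rw [show max (i - n) 0 = 0 by omega] at hSi
          omega
        rw [this, mul_zero, mul_zero, add_zero]
        exact hold.trans (Nat.pow_le_pow_right (by norm_num) (by omega))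
      · rw [max_eq_left (by omega), pow_zero] at hSi
        -- Here `2 ^ 52 = 256 ^ 7 / 16`; this 1/16 turns `2 ^ (k - n)` into `D = 2 ^ (k - n - 4)`.
        have hw : wt 6 l * 2 ^ (6 * (P - 8)) ≤ 2 ^ (4 + 6 * P) := by
          calc _ ≤ 2 ^ 52 * 2 ^ (6 * (P - 8)) := Nat.mul_le_mul_right _ hl.2.1
            _ = _ := by rw [← pow_add]; congr 1; omega
        have hnew := Nat.mul_le_mul_left (2 ^ e * 2 ^ (4 + 6 * P)) hSi
        have e1 : 2 ^ e * 2 ^ (4 + 6 * P) * 2 ^ (i - n) = 2 ^ (8 * 2 ^ n - n - 4) := by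
          rw [← pow_add, ← pow_add]; congr 1; omega
        -- By `h2` the older generations fit into the slack 1 of `hSi`, so no constant is lost.
        have e2 : 2 ^ (e + 9 + 2 ^ n + 5 * P) ≤ 2 ^ e * 2 ^ (4 + 6 * P) := by
          rw [← pow_add]; exact Nat.pow_le_pow_right (by norm_num) (by omega)
        rw [e1, mul_add, mul_one] at hnew
        have e4 : 2 ^ e * (wt 6 l * 2 ^ (6 * (P - 8)) * lv (slots n 0) i) ≤
            2 ^ e * 2 ^ (4 + 6 * P) * lv (slots n 0) i := by
          rw [← mul_assoc]
          exact Nat.mul_le_mul_right _ (Nat.mul_le_mul_left _ hw)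
        linarith
    -- In the first 8 levels of a period, `k ≤ 7 * P` hides generation 7, and the rest is small.
    · have hlv := lv_sched_le hP hS 7 (b :: l) hl (8 * 2 ^ n + 8) (by omega)
      have hg : geo P 7 ≤ 2 ^ (6 * P + 1) := by
        have : geo P 7 + 1 ≤ _ := geo_succ_add_one_le (show 1 ≤ P by omega) 6
        omega
      rw [show 8 * 2 ^ n + 8 - 8 - 7 * P = 0 by omega, lv_zero, mul_zero, add_zero] at hlv
      refine hlv.trans ?_
      calc _ ≤ 2 ^ (8 + 2 ^ n) * 2 ^ (6 * P + 1) := by gcongr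
        _ = 2 ^ (8 + 2 ^ n + (6 * P + 1)) := by rw [← pow_add]
        _ ≤ _ := Nat.pow_le_pow_right (by norm_num) (by omega)

/-- A schedule that meets the constraint of `Admissible` and ends after finitely many periods. -/
def schedule : List ℕ :=
  [0, 0, 0, 0, 0, 0, 0, 16, 17, 18, 19, 21, 23, 25, 26, 27, 28, 29, 30, 31, 32, 33, 34, 35, 36, 37,
    38, 39, 40, 41, 42, 43, 44, 46, 47, 49, 51, 53, 56, 59, 63, 68, 75, 85, 101, 131, 206]

/-- For slowly varying entries `256 * x` the constraint reads `x * (1 - x) ^ 6 ≤ 1 / 16`, which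
holds strictly for all `x` in `[0, 1]`; this leaves room to increase the entries until every branch
ends. -/
theorem admissible_schedule : Admissible schedule := by
  simp [schedule, Admissible, wt]

theorem lv_sched_schedule {k P : ℕ} (hP : 8 ≤ P) (h : k ≤ 7 * P) (S : BTree) :
    lv (sched P S schedule) k = 0 := by
  have key : ∀ l r, lv (sched P S (0 :: l)) r = 2 ^ P * lv (sched P S l) (r - P) := fun l r => by
    have e3 : (2 : ℕ) ^ P = 256 * 2 ^ (P - 8) := by
      rw [show (256 : ℕ) = 2 ^ 8 by norm_num, ← pow_add]; congr 1; omega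
    rw [lv_sched_cons hP S (by norm_num), e3]
    simp
  simp only [schedule, key]
  rw [show k - P - P - P - P - P - P - P = 0 by omega]
  simp

theorem mul_add_le_two_pow {n : ℕ} (hn : 9 ≤ n) : 7 * (n + 20) ≤ 2 ^ n := by
  induction n, hn using Nat.le_induction with
  | base => norm_num
  | succ n hn ih => rw [pow_succ]; omega

theorem exists_tree_pow {m : ℕ} (hm : 12 ≤ m) :
    ∃ t : BTree, Ok (2 ^ m) (2 ^ (2 ^ m - m - 1)) t ∧ lv t (2 ^ m) = 0 := by
  obtain ⟨n, rfl⟩ : ∃ n, m = n + 3 := ⟨m - 3, by omega⟩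
  have hn := mul_add_le_two_pow (show 9 ≤ n by omega)
  have e1 : 2 ^ (n + 3) = 8 * 2 ^ n := by ring
  rw [e1, show 8 * 2 ^ n - (n + 3) - 1 = 8 * 2 ^ n - n - 4 by omega]
  -- The least integer above `k / 7`; `hn` pays for the rounding in the third inequality.
  set P := 8 * 2 ^ n / 7 + 1 with hP
  exact ⟨sched P (slots n 0) schedule,
    ok_sched (by omega) (by omega) (by omega) (by omega) _ admissible_schedule,
    lv_sched_schedule (by omega) (by omega) _⟩

theorem exists_tree_pow_add {m : ℕ} (hm : 12 ≤ m) (j : ℕ) :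
    ∃ t : BTree, Ok (2 ^ m + j) (2 ^ (2 ^ m - m - 1 + j)) t ∧ lv t (2 ^ m + j) = 0 := by
  induction j with
  | zero => exact exists_tree_pow hm
  | succ j ih =>
    obtain ⟨t, ht, h0⟩ := ih
    refine ⟨t.dbl, ?_, ?_⟩
    · have := ht.dbl (by have := Nat.one_le_two_pow (n := m); omega)
      rw [← add_assoc, ← add_assoc, pow_succ 2 (_ + j), mul_comm _ 2]
      exact this
    · rw [← add_assoc, lv_dbl_succ, h0]

theorem exists_tree (k : ℕ) : ∃ D t, Ok k D t ∧ lv t k = 0 := by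
  refine ⟨2 ^ k, full k leaf, ok_of_forall_lv_le fun r => ?_, by simp [lv_full]⟩
  rw [lv_full]
  exact (Nat.mul_le_mul_left _ (lv_leaf_le _)).trans (by simp)

end BTree

end KSat

/-! ### From trees to unsatisfiable balanced formulas. -/

namespace KSat

namespace BTree

/-- The leaves of a tree, as words over `Bool` describing the way from the root. -/
def leaves : BTree → Finset (List Bool)
  | leaf => {[]}
  | node l r => (leaves l).image (List.cons false) ∪ (leaves r).image (List.cons true)

theorem card_leaves_filter (t : BTree) (k : ℕ) :
    ((leaves t).filter fun p => p.length < k).card ≤ lv t k := by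
  induction t generalizing k with
  | leaf => cases k <;> simp [leaves, Finset.filter_singleton]
  | node l r hl hr =>
    cases k with
    | zero => simp
    | succ k =>
      rw [leaves, Finset.filter_union, lv_node_succ, Finset.filter_image, Finset.filter_image]
      refine (Finset.card_union_le _ _).trans (add_le_add ?_ ?_)
      · exact Finset.card_image_le.trans (by simpa using hl k)
      · exact Finset.card_image_le.trans (by simpa using hr k)

theorem le_length_of_mem_leaves {t : BTree} {k : ℕ} (h : lv t k = 0) {p : List Bool}
    (hp : p ∈ leaves t) : k ≤ p.length := by
  induction t generalizing k p with
  | leaf =>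
    cases k with
    | zero => simp
    | succ k => simp at h
  | node l r hl hr =>
    cases k with
    | zero => simp
    | succ k =>
      simp only [lv_node_succ, Nat.add_eq_zero_iff] at h
      simp only [leaves, Finset.mem_union, Finset.mem_image] at hp
      rcases hp with ⟨p, hp, rfl⟩ | ⟨p, hp, rfl⟩
      · simpa using hl h.1 hp
      · simpa using hr h.2 hp

theorem Ok.card_leaves_filter_prefix {t : BTree} {k D : ℕ} (h : Ok k D t) (u : List Bool) :
    ((leaves t).filter fun p => u <+: p ∧ p.length < u.length + k).card ≤ D := by
  induction u generalizing t with
  | nil => simpa using (card_leaves_filter t k).trans h.lv_le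
  | cons c u ih =>
    cases t with
    | leaf => simp [leaves, Finset.filter_singleton]
    | node l r =>
      have key : ((leaves (node l r)).filter
          fun p => (c :: u) <+: p ∧ p.length < (c :: u).length + k) ⊆
          ((leaves (if c then r else l)).filter
            fun p => u <+: p ∧ p.length < u.length + k).image (List.cons c) := by
        intro p hp
        simp only [leaves, Finset.mem_filter, Finset.mem_union, Finset.mem_image] at hp ⊢
        obtain ⟨⟨p, hp, rfl⟩ | ⟨p, hp, rfl⟩, h1, h2⟩ := hp
        all_goals
          rw [List.cons_prefix_cons] at h1
          obtain ⟨rfl, h1⟩ := h1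
          simp only [List.length_cons] at h2
          exact ⟨p, ⟨by simpa using hp, h1, by omega⟩, rfl⟩
      refine (Finset.card_le_card key).trans (Finset.card_image_le.trans (ih ?_))
      cases c
      · exact h.2.1
      · exact h.2.2

/-- The clause formed by the last `k` edges on the way to a leaf. -/
def pathClause (k : ℕ) (p : List Bool) : Clause :=
  (Finset.Ico (p.length - k) p.length).image fun i => (Encodable.encode (p.take i), p.getD i false)

theorem card_pathClause {k : ℕ} {p : List Bool} (h : k ≤ p.length) :
    (pathClause k p).card = k := by
  rw [pathClause, Finset.card_image_of_injOn]
  · simp; omega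
  · intro i hi j hj hij
    simp only [Finset.coe_Ico, Set.mem_Ico] at hi hj
    have h1 := congrArg List.length (Encodable.encode_injective (Prod.ext_iff.1 hij).1)
    simp only [List.length_take] at h1
    omega

/-- The formula whose clauses belong to the leaves of a tree. -/
def formula (k : ℕ) (t : BTree) : Formula := (leaves t).image (pathClause k)

/-- The literal `(u, b)` is the edge from `u` to `u ++ [b]`; its clauses come from leaves at
distance less than `k` below the lower end. -/
theorem Ok.litOcc_formula_le {t : BTree} {k D : ℕ} (h : Ok k D t) (x : Literal) :
    litOcc (formula k t) x ≤ D := by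
  obtain ⟨x, b⟩ := x
  by_cases hx : ∃ u : List Bool, Encodable.encode u = x
  · obtain ⟨u, rfl⟩ := hx
    refine le_trans ?_ (h.card_leaves_filter_prefix (u ++ [b]))
    rw [litOcc, formula, Finset.filter_image]
    refine Finset.card_image_le.trans (Finset.card_le_card ?_)
    intro p hp
    obtain ⟨hp', hx⟩ := Finset.mem_filter.1 hp
    simp only [pathClause, Finset.mem_image, Finset.mem_Ico, Prod.mk.injEq] at hx
    obtain ⟨i, ⟨h1, h2⟩, h3, rfl⟩ := hx
    obtain rfl := Encodable.encode_injective h3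
    refine Finset.mem_filter.2 ⟨hp', ?_, ?_⟩
    · rw [List.getD_eq_getElem _ _ h2, List.take_append_getElem]
      exact List.take_prefix _ _
    · simp only [List.length_append, List.length_take, List.length_singleton]
      omega
  · rw [litOcc, Finset.card_eq_zero.2]
    · omega
    · refine Finset.filter_eq_empty_iff.2 fun C hC hl => hx ?_
      simp only [formula, Finset.mem_image] at hC
      obtain ⟨p, -, rfl⟩ := hC
      simp only [pathClause, Finset.mem_image, Prod.mk.injEq] at hl
      obtain ⟨i, -, hi, -⟩ := hl
      exact ⟨_, hi⟩

theorem exists_leaf_against (t : BTree) (β : List Bool → Bool) :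
    ∃ p ∈ leaves t, ∀ i < p.length, p.getD i false = !β (p.take i) := by
  induction t generalizing β with
  | leaf => exact ⟨[], by simp [leaves], by simp⟩
  | node l r hl hr =>
    have key : ∀ c p, c = (!β []) →
        (∀ i < p.length, p.getD i false = !β (c :: p.take i)) →
        ∀ i < (c :: p).length, (c :: p).getD i false = !β ((c :: p).take i) := by
      intro c p hc hp i hi
      cases i with
      | zero => simpa using hc
      | succ i => simpa using hp i (by simpa using hi)
    cases hc : β [] with
    | true =>
      obtain ⟨p, hp, h⟩ := hl fun u => β (false :: u)
      exact ⟨false :: p, by simp [leaves, hp], key _ _ (by simp [hc]) h⟩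
    | false =>
      obtain ⟨p, hp, h⟩ := hr fun u => β (true :: u)
      exact ⟨true :: p, by simp [leaves, hp], key _ _ (by simp [hc]) h⟩

theorem not_satisfiable_formula (k : ℕ) (t : BTree) : ¬ Satisfiable (formula k t) := by
  rintro ⟨α, hα⟩
  obtain ⟨p, hp, h⟩ := exists_leaf_against t fun u => α (Encodable.encode u)
  obtain ⟨x, hx, hαx⟩ := hα (pathClause k p) (Finset.mem_image_of_mem _ hp)
  simp only [pathClause, Finset.mem_image, Finset.mem_Ico] at hx
  obtain ⟨i, hi, rfl⟩ := hx
  exact absurd (hαx.trans (h i hi.2)) (by simp)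

end BTree

theorem varOcc_le (F : Formula) (x : ℕ) : varOcc F x ≤ litOcc F (x, true) + litOcc F (x, false) := by
  rw [varOcc, Finset.filter_or]
  exact Finset.card_union_le _ _

theorem exists_balanced_not_satisfiable {k D : ℕ} {t : BTree} (h : t.Ok k D)
    (h0 : t.lv k = 0) : ∃ F, IsBalancedKS k (2 * D) F ∧ ¬ Satisfiable F := by
  refine ⟨t.formula k, ⟨⟨?_, fun x => ?_⟩, fun x => ?_⟩, t.not_satisfiable_formula k⟩
  · intro C hC
    simp only [BTree.formula, Finset.mem_image] at hC
    obtain ⟨p, hp, rfl⟩ := hC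
    exact BTree.card_pathClause (BTree.le_length_of_mem_leaves h0 hp)
  · have := varOcc_le (t.formula k) x
    have := h.litOcc_formula_le (x, true)
    have := h.litOcc_formula_le (x, false)
    omega
  · have : (litOcc (t.formula k) x : ℝ) ≤ D := by exact_mod_cast h.litOcc_formula_le x
    push_cast
    linarith

end KSat

/-! ### The local lemma by counting models. -/

namespace KSat

/-- The variables of a clause. -/
def vars (C : Clause) : Finset ℕ := C.image Prod.fst

/-- The clause `C` is true when exactly the variables in `A` are. -/
def Holds (A : Finset ℕ) (C : Clause) : Prop := ∃ l ∈ C, decide (l.1 ∈ A) = l.2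

theorem holds_congr {A B : Finset ℕ} {C : Clause} (h : ∀ x ∈ vars C, (x ∈ A ↔ x ∈ B)) :
    Holds A C ↔ Holds B C := by
  refine exists_congr fun l => and_congr_right fun hl => ?_
  rw [decide_eq_decide.2 (h l.1 (Finset.mem_image_of_mem _ hl))]

open Classical in
/-- The satisfying assignments of `F` on the set `V` of variables. -/
noncomputable def models (V : Finset ℕ) (F : Formula) : Finset (Finset ℕ) :=
  V.powerset.filter fun A => ∀ C ∈ F, Holds A C

open Classical in
/-- The assignments that satisfy `F` and violate `C`. -/
noncomputable def violators (V : Finset ℕ) (F : Formula) (C : Clause) : Finset (Finset ℕ) :=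
  (models V F).filter fun A => ¬ Holds A C

theorem mem_models {V : Finset ℕ} {F : Formula} {A : Finset ℕ} :
    A ∈ models V F ↔ A ⊆ V ∧ ∀ C ∈ F, Holds A C := by
  simp [models]

theorem mem_violators {V : Finset ℕ} {F : Formula} {C : Clause} {A : Finset ℕ} :
    A ∈ violators V F C ↔ (A ⊆ V ∧ ∀ C ∈ F, Holds A C) ∧ ¬ Holds A C := by
  simp [violators, mem_models]

theorem card_models_insert (V : Finset ℕ) (F : Formula) (C : Clause) :
    (models V (insert C F)).card + (violators V F C).card = (models V F).card := by
  classical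
  rw [← Finset.card_filter_add_card_filter_not (s := models V F) (fun A => Holds A C)]
  congr 2
  ext A
  simp only [mem_models, Finset.mem_filter, Finset.forall_mem_insert]
  tauto

/-- Violation of a clause is independent of formulas in other variables. -/
theorem two_pow_mul_card_violators_le {V : Finset ℕ} {F : Formula} {C : Clause}
    (hC : vars C ⊆ V) (hF : ∀ D ∈ F, Disjoint (vars D) (vars C)) :
    2 ^ C.card * (violators V F C).card ≤ (models V F).card := by
  classical
  by_cases hinj : Set.InjOn Prod.fst (C : Set Literal)
  · have hcard : (vars C).card = C.card := Finset.card_image_of_injOn hinj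
    rw [← hcard, ← Finset.card_powerset, mul_comm, ← Finset.card_product]
    -- Overwrite `A` on `vars C` by `B`. As `A` violates `C`, its values there are forced, so the
    -- pair can be recovered.
    refine Finset.card_le_card_of_injOn (fun p => (p.1 \ vars C) ∪ p.2) ?_ ?_
    · rintro ⟨A, B⟩ h
      simp only [Finset.coe_product, Set.mem_prod, Finset.mem_coe, mem_violators,
        Finset.mem_powerset] at h
      obtain ⟨⟨⟨hA, hsat⟩, -⟩, hB⟩ := h
      refine Finset.mem_coe.2 (mem_models.2 ⟨?_, fun D hD => ?_⟩)
      · exact Finset.union_subset (Finset.sdiff_subset.trans hA) (hB.trans hC)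
      · refine (holds_congr fun x hx => ?_).1 (hsat D hD)
        have h1 := Finset.disjoint_left.1 (hF D hD) hx
        have h2 : x ∉ B := fun h => h1 (hB h)
        simp [h1, h2]
    · rintro ⟨A, B⟩ h ⟨A', B'⟩ h' heq
      simp only [Finset.coe_product, Set.mem_prod, Finset.mem_coe, mem_violators,
        Finset.mem_powerset, Holds, not_exists, not_and] at h h'
      obtain ⟨⟨-, hA⟩, hB⟩ := h
      obtain ⟨⟨-, hA'⟩, hB'⟩ := h'
      have hmem : ∀ x, (x ∈ A ∧ x ∉ vars C) ∨ x ∈ B ↔ (x ∈ A' ∧ x ∉ vars C) ∨ x ∈ B' := by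
        intro x
        simpa using Finset.ext_iff.1 heq x
      have hAA : A = A' := by
        ext x
        by_cases hx : x ∈ vars C
        · obtain ⟨l, hl, rfl⟩ := Finset.mem_image.1 hx
          have h1 := hA l hl
          have h2 := hA' l hl
          by_cases ha : l.1 ∈ A <;> by_cases ha' : l.1 ∈ A' <;> simp_all
        · have h1 : x ∉ B := fun h => hx (hB h)
          have h2 : x ∉ B' := fun h => hx (hB' h)
          simpa [hx, h1, h2] using hmem x
      have hBB : B = B' := by
        ext x
        by_cases hx : x ∈ vars C
        · simpa [hx] using hmem x
        · exact iff_of_false (fun h => hx (hB h)) (fun h => hx (hB' h))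
      rw [hAA, hBB]
  -- A clause containing a variable and its negation is never violated.
  · have : violators V F C = ∅ := by
      refine Finset.eq_empty_of_forall_notMem fun A hA => hinj ?_
      have h := (mem_violators.1 hA).2
      simp only [Holds, not_exists, not_and] at h
      intro l hl l' hl' hll
      have h1 := h l hl
      have h2 := h l' hl'
      rw [← hll] at h2
      refine Prod.ext hll ?_
      revert h1 h2
      cases l.2 <;> cases l'.2 <;> simp
    simp [this]

/-- The local lemma for clauses of size `k`, in conditional form. -/
theorem card_models_insert_ge {V : Finset ℕ} {F : Formula} {k d : ℕ} (hk : 1 ≤ k)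
    (hcard : ∀ C ∈ F, C.card = k) (hV : ∀ C ∈ F, vars C ⊆ V)
    (hd : ∀ C ∈ F, (F.filter fun D => ¬ Disjoint (vars D) (vars C)).card ≤ d)
    (hdk : 4 * d ≤ 2 ^ k) (n : ℕ) :
    ∀ G ⊆ F, G.card ≤ n → ∀ C ∈ F,
      (1 - 2 / 2 ^ k : ℝ) * (models V G).card ≤ (models V (insert C G)).card := by
  have hk2 : (2 : ℝ) ≤ 2 ^ k := by
    calc (2 : ℝ) = 2 ^ 1 := by norm_num
      _ ≤ 2 ^ k := pow_le_pow_right₀ (by norm_num) hk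
  have hx0 : (0 : ℝ) ≤ 1 - 2 / 2 ^ k := by
    rw [sub_nonneg, div_le_one (by positivity)]; exact hk2
  induction n using Nat.strong_induction_on with
  | _ n ih =>
  intro G hG hGn C hC
  set G₁ := G.filter fun D => Disjoint (vars D) (vars C) with hG₁
  set G₂ := G.filter fun D => ¬ Disjoint (vars D) (vars C) with hG₂
  have hunion : G₁ ∪ G₂ = G := Finset.filter_union_filter_not_eq _ _
  have hdisj : Disjoint G₁ G₂ := Finset.disjoint_filter_filter_not _ _ _
  -- The neighbours of `C` are added to `G₁` one at a time, each by the induction hypothesis.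
  have hchain : ∀ H ⊆ G₂, (1 - 2 / 2 ^ k : ℝ) ^ H.card * (models V G₁).card
      ≤ (models V (G₁ ∪ H)).card := by
    intro H
    induction H using Finset.induction_on with
    | empty => simp
    | insert D H hD ihH =>
      intro hH
      have hDG := hH (Finset.mem_insert_self D H)
      have hHG := (Finset.subset_insert D H).trans hH
      have hlt : (G₁ ∪ H).card < G.card := by
        refine Finset.card_lt_card (Finset.ssubset_iff.2 ⟨D, ?_, ?_⟩)
        · simp only [Finset.mem_union, not_or]
          exact ⟨Finset.disjoint_right.1 hdisj hDG, hD⟩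
        · rw [← Finset.union_insert, ← hunion]
          exact Finset.union_subset_union_right hH
      have hsub : G₁ ∪ H ⊆ F := (hunion ▸ Finset.union_subset_union_right hHG).trans hG
      have hDF : D ∈ F := hG (Finset.mem_of_mem_filter D hDG)
      have h1 := ih _ (hlt.trans_le hGn) (G₁ ∪ H) hsub le_rfl D hDF
      rw [Finset.card_insert_of_notMem hD, pow_succ', mul_assoc, Finset.union_insert]
      exact (mul_le_mul_of_nonneg_left (ihH hHG) hx0).trans h1
  have h2 := hchain G₂ subset_rfl
  rw [hunion] at h2
  have hG₂d : G₂.card ≤ d := (Finset.card_le_card (Finset.filter_subset_filter _ hG)).trans (hd C hC)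
  -- Bernoulli's inequality: at most `2 ^ k / 4` neighbours remove at most half of the models,
  -- whence the 2 in `2 / 2 ^ k`.
  have hbern : (1 / 2 : ℝ) ≤ (1 - 2 / 2 ^ k) ^ G₂.card := by
    have hb := one_add_mul_le_pow (a := -(2 / 2 ^ k : ℝ)) (by linarith) G₂.card
    rw [← sub_eq_add_neg] at hb
    refine le_trans ?_ hb
    have hd' : (4 * G₂.card : ℝ) ≤ 2 ^ k := by
      exact_mod_cast (Nat.mul_le_mul_left 4 hG₂d).trans hdk
    have : (G₂.card : ℝ) * (2 / 2 ^ k) ≤ 1 / 2 := by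
      rw [← mul_div_assoc, div_le_iff₀ (by positivity)]; linarith
    linarith
  have h3 : (1 / 2 : ℝ) * (models V G₁).card ≤ (models V G).card :=
    (mul_le_mul_of_nonneg_right hbern (Nat.cast_nonneg _)).trans h2
  have hsubset : violators V G C ⊆ violators V G₁ C := by
    intro A hA
    rw [mem_violators] at hA ⊢
    exact ⟨⟨hA.1.1, fun D hD => hA.1.2 D (Finset.mem_of_mem_filter D hD)⟩, hA.2⟩
  have h4 : 2 ^ k * (violators V G C).card ≤ (models V G₁).card := by
    have := two_pow_mul_card_violators_le (F := G₁) (hV C hC)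
      fun D hD => (Finset.mem_filter.1 hD).2
    rw [hcard C hC] at this
    exact (Nat.mul_le_mul_left _ (Finset.card_le_card hsubset)).trans this
  have h5 : (2 ^ k * (violators V G C).card : ℝ) ≤ (models V G₁).card := by exact_mod_cast h4
  have h6 : ((models V (insert C G)).card + (violators V G C).card : ℝ) = (models V G).card := by
    exact_mod_cast card_models_insert V G C
  have h7 : ((violators V G C).card : ℝ) ≤ 2 / 2 ^ k * (models V G).card := by
    rw [div_mul_eq_mul_div, le_div_iff₀ (by positivity)]
    linarith
  linarith

/-- A `k`-CNF formula in which every clause shares variables with at most `2 ^ k / 4` clauses is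
satisfiable. -/
theorem satisfiable_of_card_neighbors_le {F : Formula} {k d : ℕ} (hk : 2 ≤ k)
    (hcard : ∀ C ∈ F, C.card = k)
    (hd : ∀ C ∈ F, (F.filter fun D => ¬ Disjoint (vars D) (vars C)).card ≤ d)
    (hdk : 4 * d ≤ 2 ^ k) : Satisfiable F := by
  set V := F.biUnion vars
  have hV : ∀ C ∈ F, vars C ⊆ V := fun C hC => Finset.subset_biUnion_of_mem vars hC
  have hx : (0 : ℝ) < 1 - 2 / 2 ^ k := by
    have : (2 : ℝ) ^ 2 ≤ 2 ^ k := pow_le_pow_right₀ (by norm_num) hk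
    rw [sub_pos, div_lt_one (by positivity)]
    linarith
  have hpos : ∀ G ⊆ F, 0 < (models V G).card := by
    intro G
    induction G using Finset.induction_on with
    | empty => exact fun _ => Finset.card_pos.2 ⟨∅, mem_models.2 ⟨by simp, by simp⟩⟩
    | insert C G hC ih =>
      intro hG
      have hGF := (Finset.subset_insert C G).trans hG
      have h1 := card_models_insert_ge (by omega) hcard hV hd hdk _ G hGF le_rfl C
        (hG (Finset.mem_insert_self C G))
      have h2 : (0 : ℝ) < (models V G).card := by exact_mod_cast ih hGF
      exact_mod_cast (mul_pos hx h2).trans_le h1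
  obtain ⟨A, hA⟩ := Finset.card_pos.1 (hpos F subset_rfl)
  exact ⟨fun x => decide (x ∈ A), (mem_models.1 hA).2⟩

theorem card_neighbors_le {F : Formula} {s : ℕ} (hs : ∀ x, varOcc F x ≤ s) (C : Clause) :
    (F.filter fun D => ¬ Disjoint (vars D) (vars C)).card ≤ C.card * s := by
  classical
  have hsub : (F.filter fun D => ¬ Disjoint (vars D) (vars C)) ⊆
      (vars C).biUnion fun x => F.filter fun D => (x, true) ∈ D ∨ (x, false) ∈ D := by
    intro D hD
    obtain ⟨hDF, hD⟩ := Finset.mem_filter.1 hD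
    obtain ⟨x, hxD, hxC⟩ := Finset.not_disjoint_iff.1 hD
    obtain ⟨⟨x, b⟩, hl, rfl⟩ := Finset.mem_image.1 hxD
    refine Finset.mem_biUnion.2 ⟨x, hxC, Finset.mem_filter.2 ⟨hDF, ?_⟩⟩
    cases b
    · exact Or.inr hl
    · exact Or.inl hl
  refine (Finset.card_le_card hsub).trans ((Finset.card_biUnion_le_card_mul _ _ s ?_).trans ?_)
  · exact fun x _ => hs x
  · exact Nat.mul_le_mul_right _ Finset.card_image_le

theorem satisfiable_of_isKS {k s : ℕ} (hk : 2 ≤ k) (h : 4 * (k * s) ≤ 2 ^ k) {F : Formula}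
    (hF : IsKS k s F) : Satisfiable F :=
  satisfiable_of_card_neighbors_le hk hF.1
    (fun C hC => hF.1 C hC ▸ card_neighbors_le hF.2 C) h

end KSat

/-! ### Bounds for `f` and `fBal`. -/

namespace KSat

theorem isKS_of_le {k s t : ℕ} (h : s ≤ t) {F : Formula} (hF : IsKS k s F) : IsKS k t F :=
  ⟨hF.1, fun x => (hF.2 x).trans h⟩

theorem isBalancedKS_of_le {k s t : ℕ} (h : s ≤ t) {F : Formula} (hF : IsBalancedKS k s F) :
    IsBalancedKS k t F := by
  have : (s : ℝ) ≤ t := by exact_mod_cast h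
  exact ⟨isKS_of_le h hF.1, fun l => (hF.2 l).trans (by linarith)⟩

theorem satSet_subset_satSetBal (k : ℕ) : satSet k ⊆ satSetBal k := fun _ h F hF => h F hF.1

theorem zero_mem_satSet {k : ℕ} (hk : 1 ≤ k) : 0 ∈ satSet k := by
  intro F hF
  refine ⟨fun _ => true, fun C hC => ?_⟩
  obtain ⟨⟨x, b⟩, hl⟩ := Finset.card_pos.1 (by rw [hF.1 C hC]; omega : 0 < C.card)
  have h0 := Finset.card_eq_zero.1 (Nat.le_zero.1 (hF.2 x))
  refine absurd (Finset.filter_eq_empty_iff.1 h0 hC) (not_not.2 ?_)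
  cases b
  · exact Or.inr hl
  · exact Or.inl hl

theorem lt_of_mem_satSetBal {k D s : ℕ} {t : BTree} (h : t.Ok k D) (h0 : t.lv k = 0)
    (hs : s ∈ satSetBal k) : s < 2 * D := by
  obtain ⟨F, hF, hF'⟩ := exists_balanced_not_satisfiable h h0
  by_contra hlt
  exact hF' (hs F (isBalancedKS_of_le (not_lt.1 hlt) hF))

theorem bddAbove_satSetBal (k : ℕ) : BddAbove (satSetBal k) := by
  obtain ⟨D, t, h, h0⟩ := BTree.exists_tree k
  exact ⟨2 * D, fun s hs => (lt_of_mem_satSetBal h h0 hs).le⟩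

theorem bddAbove_satSet (k : ℕ) : BddAbove (satSet k) :=
  (bddAbove_satSetBal k).mono (satSet_subset_satSetBal k)

theorem isGreatest_f {k : ℕ} (hk : 1 ≤ k) : IsGreatest (satSet k) (f k) :=
  ⟨Nat.sSup_mem ⟨0, zero_mem_satSet hk⟩ (bddAbove_satSet k), fun _ hs =>
    le_csSup (bddAbove_satSet k) hs⟩

theorem isGreatest_fBal {k : ℕ} (hk : 1 ≤ k) : IsGreatest (satSetBal k) (fBal k) :=
  ⟨Nat.sSup_mem ⟨0, satSet_subset_satSetBal k (zero_mem_satSet hk)⟩ (bddAbove_satSetBal k),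
    fun _ hs => le_csSup (bddAbove_satSetBal k) hs⟩

theorem fBal_pow_add_le {m : ℕ} (hm : 12 ≤ m) (j : ℕ) :
    (fBal (2 ^ m + j) : ℝ) ≤ 2 ^ (2 ^ m + j) / 2 ^ m - 1 := by
  obtain ⟨t, h, h0⟩ := BTree.exists_tree_pow_add hm j
  have hpos := Nat.one_le_two_pow (n := m)
  have hlt := lt_of_mem_satSetBal h h0 (isGreatest_fBal (by omega)).1
  have hm' : m < 2 ^ m := Nat.lt_two_pow_self
  have e : 2 * 2 ^ (2 ^ m - m - 1 + j) * 2 ^ m = 2 ^ (2 ^ m + j) := by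
    rw [← pow_succ', ← pow_add]; congr 1; omega
  rw [le_sub_iff_add_le, le_div_iff₀ (by positivity)]
  have h1 : (fBal (2 ^ m + j) + 1) * 2 ^ m ≤ 2 ^ (2 ^ m + j) := by
    rw [← e]; exact Nat.mul_le_mul_right _ hlt
  exact_mod_cast h1

/-- With `2 ^ m` the largest power of 2 up to `k`, replacing `2 ^ m` by `k` in the denominator costs
at most a factor 2. -/
theorem fBal_le {k : ℕ} (hk : 2 ^ 12 ≤ k) : (fBal k : ℝ) ≤ 2 * ((2 : ℝ) ^ k / k) - 1 := by
  have hk0 : k ≠ 0 := by rintro rfl; norm_num at hk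
  set m := Nat.log 2 k with hm
  have h12 : 12 ≤ m := Nat.le_log_of_pow_le (by norm_num) hk
  have h1 : 2 ^ m ≤ k := Nat.pow_log_le_self 2 hk0
  have h2 : k < 2 ^ (m + 1) := Nat.lt_pow_succ_log_self (by norm_num) k
  obtain ⟨j, hj⟩ := Nat.exists_eq_add_of_le h1
  have h3 := fBal_pow_add_le h12 j
  rw [← hj] at h3
  refine h3.trans (sub_le_sub_right ?_ 1)
  have hkpos : (0 : ℝ) < k := by exact_mod_cast Nat.pos_of_ne_zero hk0
  have h4 : (k : ℝ) ≤ 2 * 2 ^ m := by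
    rw [pow_succ'] at h2; exact_mod_cast h2.le
  rw [← mul_div_assoc, div_le_div_iff₀ (by positivity) hkpos]
  nlinarith [pow_pos (show (0 : ℝ) < 2 by norm_num) k]

theorem f_le_fBal {k : ℕ} (hk : 1 ≤ k) : f k ≤ fBal k :=
  (isGreatest_fBal hk).2 (satSet_subset_satSetBal k (isGreatest_f hk).1)

theorem two_pow_div_le_f {k : ℕ} (hk : 6 ≤ k) : (2 : ℝ) ^ k / k ≤ 8 * f k := by
  have hk8 : 8 * k ≤ 2 ^ k := by
    induction k, hk using Nat.le_induction with
    | base => norm_num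
    | succ n hn ih => rw [pow_succ]; omega
  have hpos : 0 < 4 * k := by omega
  set s := 2 ^ k / (4 * k) with hs
  have hmul : 4 * (k * s) ≤ 2 ^ k := by
    rw [← mul_assoc]; exact Nat.mul_div_le _ _
  have hmem : s ∈ satSet k := fun F hF => satisfiable_of_isKS (by omega) hmul hF
  have hsf : s ≤ f k := (isGreatest_f (by omega)).2 hmem
  -- Then `s + 1 ≤ 2 * s`, so rounding turns the constant 4 into 8.
  have h1 : 1 ≤ s := (Nat.one_le_div_iff hpos).2 (by omega)
  have h2 : 2 ^ k < 4 * k * (s + 1) := Nat.lt_mul_div_succ _ hpos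
  have h3 : 2 ^ k ≤ 8 * f k * k := by nlinarith
  rw [div_le_iff₀ (by exact_mod_cast (by omega : 0 < k))]
  exact_mod_cast h3

end KSat

theorem theorem1p7 :
    -- the maxima that define `f(k)` and `f_bal(k)` exist
    (∀ k : ℕ, 1 ≤ k →
      IsGreatest (KSat.satSet k) (KSat.f k) ∧ IsGreatest (KSat.satSetBal k) (KSat.fBal k)) ∧
    (∃ K : ℕ, ∀ k : ℕ, K ≤ k → (∃ m : ℕ, k = 2 ^ m) →
      (KSat.fBal k : ℝ) ≤ (2 : ℝ) ^ k / (k : ℝ) - 1) ∧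
    (∃ K : ℕ, ∀ k : ℕ, K ≤ k →
      (KSat.fBal k : ℝ) ≤ 2 * ((2 : ℝ) ^ k / (k : ℝ)) - 1) ∧
    (fun k : ℕ => (KSat.f k : ℝ)) =Θ[atTop] (fun k : ℕ => (2 : ℝ) ^ k / (k : ℝ)) := by
  refine ⟨fun k hk => ⟨KSat.isGreatest_f hk, KSat.isGreatest_fBal hk⟩,
    ⟨2 ^ 12, ?_⟩, ⟨2 ^ 12, fun k hk => KSat.fBal_le hk⟩, ?_, ?_⟩
  · rintro _ hk ⟨m, rfl⟩
    have hm : 12 ≤ m := (Nat.pow_le_pow_iff_right (by norm_num)).1 hk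
    simpa using KSat.fBal_pow_add_le hm 0
  · refine IsBigO.of_bound 2 ?_
    filter_upwards [eventually_ge_atTop (2 ^ 12)] with k hk
    have h1 := KSat.fBal_le hk
    have h2 : (KSat.f k : ℝ) ≤ KSat.fBal k := by
      exact_mod_cast KSat.f_le_fBal (le_trans (by norm_num) hk)
    rw [Real.norm_of_nonneg (by positivity), Real.norm_of_nonneg (by positivity)]
    linarith
  · refine IsBigO.of_bound 8 ?_
    filter_upwards [eventually_ge_atTop 6] with k hk
    rw [Real.norm_of_nonneg (by positivity), Real.norm_of_nonneg (by positivity)]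
    exact KSat.two_pow_div_le_f hk
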